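/- Let $G_{16}$ be the graph with vertex set $\{0,1\}^{16}$ in which two strings $u,v$ are adjacent if and only if their Hamming distance is $d_H(u,v)=8$. Let $I\subseteq\{0,1\}^{16}$ be an independent set of $G_{16}$, i.e., a set of vertices no two of which are adjacent. Then $|I|\le 3912$. -/

import Mathlib

/-- The graph `G_N` on the vertex set `{0,1}^N` in which two strings are adjacent if and only if
their Hamming distance is exactly `N / 2` (for odd `N` there are no edges). For `N ≥ 1` the clause
`u ≠ v` is implied by the second one; it only rules out a loop when `N = 0`. -/
def halfDistGraph (N : ℕ) : SimpleGraph (Fin N → Bool) where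
  Adj u v := u ≠ v ∧ 2 * hammingDist u v = N
  symm := ⟨fun u v h => ⟨h.1.symm, by rw [hammingDist_comm]; exact h.2⟩⟩
  loopless := ⟨fun _ h => h.1 rfl⟩

open Finset

/-! Split `I` into four classes by weight parity and first coordinate. Within a class distances are
even, not 16 and not 8, so an integer-valued cubic in the distance gives a matrix that is the
identity mod 2. Its determinant is odd, so it has full rank over ℚ, while its degree bounds the rank
by 697 (`rank_hammingDist_polynomial_le`). -/

/-- The subsets of `ι` with at most `r` elements. -/
def subsetsCardLE (ι : Type*) [Fintype ι] [DecidableEq ι] (r : ℕ) : Finset (Finset ι) :=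
  (range (r + 1)).biUnion fun k => powersetCard k univ

section

variable {ι : Type*} [DecidableEq ι]

/-- For bits, `[x ≠ y] = x(1 - 2y) + y`; expanding the product separates monomials in `x` from
functions of `y`, which yields the low-rank factorization. -/
theorem prod_ne_eq_sum_prod (x y : ι → Bool) (S : Finset ι) :
    (∏ i ∈ S, if x i ≠ y i then (1 : ℚ) else 0) =
      ∑ T ∈ S.powerset, (∏ i ∈ T, if x i then (1 : ℚ) else 0) *
        ((∏ i ∈ T, if y i then (-1 : ℚ) else 1) * ∏ i ∈ S \ T, if y i then (1 : ℚ) else 0) := by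
  have h : ∀ i, (if x i ≠ y i then (1 : ℚ) else 0) =
      (if x i then (1 : ℚ) else 0) * (if y i then (-1 : ℚ) else 1) + if y i then (1 : ℚ) else 0 := by
    intro i
    cases x i <;> cases y i <;> simp
  simp_rw [h]
  rw [prod_add]
  refine sum_congr rfl fun T _ => ?_
  rw [prod_mul_distrib, mul_assoc]

variable [Fintype ι]

theorem mem_subsetsCardLE {r : ℕ} {S : Finset ι} : S ∈ subsetsCardLE ι r ↔ S.card ≤ r := by
  simp [subsetsCardLE, mem_powersetCard]

theorem card_subsetsCardLE_le (r : ℕ) :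
    (subsetsCardLE ι r).card ≤ ∑ k ∈ range (r + 1), (Fintype.card ι).choose k := by
  refine card_biUnion_le.trans (sum_le_sum fun k _ => ?_)
  simp

theorem sum_subsetsCardLE (r : ℕ) (g : Finset ι → ℚ) :
    ∑ S ∈ subsetsCardLE ι r, g S = ∑ k ∈ range (r + 1), ∑ S ∈ powersetCard k univ, g S :=
  sum_biUnion fun _ _ _ _ h => pairwise_disjoint_powersetCard _ h

theorem choose_hammingDist (x y : ι → Bool) (k : ℕ) :
    ((hammingDist x y).choose k : ℚ) =
      ∑ S ∈ powersetCard k (univ : Finset ι), ∏ i ∈ S, if x i ≠ y i then 1 else 0 := by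
  have h : ∀ S : Finset ι, (∏ i ∈ S, if x i ≠ y i then (1 : ℚ) else 0) =
      if S ⊆ (univ.filter fun i => x i ≠ y i) then 1 else 0 := fun S => by
    simp only [prod_boole, subset_iff, mem_filter_univ]
    congr
  simp_rw [h]
  rw [sum_boole, hammingDist, ← card_powersetCard]
  congr 2
  ext S
  simp only [mem_powersetCard, mem_filter, subset_univ, true_and, and_comm]

/-- A matrix whose entries are a polynomial of degree `r` in the Hamming distance has rank at most
the number of multilinear monomials of degree at most `r`. -/
theorem rank_hammingDist_polynomial_le (F : Finset (ι → Bool)) (c : ℕ → ℚ) (r : ℕ) :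
    (Matrix.of fun x y : F => ∑ k ∈ range (r + 1),
      c k * ((hammingDist x.1 y.1).choose k : ℚ)).rank ≤
      ∑ k ∈ range (r + 1), (Fintype.card ι).choose k := by
  let A : Matrix F (subsetsCardLE ι r) ℚ :=
    Matrix.of fun x T => ∏ i ∈ T.1, if x.1 i then (1 : ℚ) else 0
  let b : Finset ι → F → Finset ι → ℚ := fun S y T =>
    c S.card * ((∏ i ∈ T, if y.1 i then (-1 : ℚ) else 1) *
      ∏ i ∈ S \ T, if y.1 i then (1 : ℚ) else 0)
  let B : Matrix (subsetsCardLE ι r) F ℚ :=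
    Matrix.of fun T y => ∑ S ∈ subsetsCardLE ι r with T.1 ⊆ S, b S y T.1
  have hAB : (Matrix.of fun x y : F => ∑ k ∈ range (r + 1),
      c k * ((hammingDist x.1 y.1).choose k : ℚ)) = A * B := by
    ext x y
    have h1 : ∑ k ∈ range (r + 1), c k * ((hammingDist x.1 y.1).choose k : ℚ) =
        ∑ S ∈ subsetsCardLE ι r, c S.card * ∏ i ∈ S, if x.1 i ≠ y.1 i then (1 : ℚ) else 0 := by
      rw [sum_subsetsCardLE]
      refine sum_congr rfl fun k _ => ?_
      rw [choose_hammingDist, mul_sum]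
      refine sum_congr rfl fun S hS => ?_
      rw [(mem_powersetCard.1 hS).2]
    rw [Matrix.of_apply, h1, Matrix.mul_apply]
    simp only [A, B, Matrix.of_apply]
    rw [sum_coe_sort (subsetsCardLE ι r) (fun T => (∏ i ∈ T, if x.1 i then (1 : ℚ) else 0) *
      ∑ S ∈ subsetsCardLE ι r with T ⊆ S, b S y T)]
    simp_rw [prod_ne_eq_sum_prod, mul_sum]
    rw [sum_comm' (t' := subsetsCardLE ι r)
      (s' := fun T => {S ∈ subsetsCardLE ι r | T ⊆ S})]
    · refine sum_congr rfl fun T _ => sum_congr rfl fun S _ => ?_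
      simp only [b]
      ring
    · intro S T
      simp only [mem_subsetsCardLE, mem_powerset, mem_filter]
      exact ⟨fun h => ⟨h, (card_le_card h.2).trans h.1⟩, fun h => h.1⟩
  rw [hAB]
  calc (A * B).rank ≤ A.rank := Matrix.rank_mul_le_left A B
    _ ≤ Fintype.card (subsetsCardLE ι r) := Matrix.rank_le_card_width A
    _ = (subsetsCardLE ι r).card := Fintype.card_coe _
    _ ≤ _ := card_subsetsCardLE_le r

end

theorem hammingDist_cast_zmod_two {ι : Type*} [Fintype ι] (x y : ι → Bool) :
    (hammingDist x y : ZMod 2) =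
      (∑ i, if x i then 1 else 0) + ∑ i, if y i then 1 else 0 := by
  rw [hammingDist, ← sum_boole, ← sum_add_distrib]
  refine sum_congr rfl fun i _ => ?_
  cases x i <;> cases y i <;> simp
  decide

/-- An integer matrix that is the identity modulo `2` has full rank over `ℚ`. -/
theorem rank_eq_card_of_map_zmod_two_eq_one {α : Type*} [Fintype α] [DecidableEq α]
    (M : Matrix α α ℤ) (hM : M.map (Int.castRingHom (ZMod 2)) = 1) :
    (M.map (Int.castRingHom ℚ)).rank = Fintype.card α := by
  have h2 : Int.castRingHom (ZMod 2) M.det = 1 := by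
    rw [RingHom.map_det, RingHom.mapMatrix_apply, hM, Matrix.det_one]
  have h0 : M.det ≠ 0 := by
    intro h
    simp [h] at h2
  apply Matrix.rank_of_isUnit
  rw [Matrix.isUnit_iff_isUnit_det, ← RingHom.mapMatrix_apply, ← RingHom.map_det]
  exact isUnit_iff_ne_zero.2 (by simpa using h0)

/-- A family of strings whose pairwise distances are even and different from `8` and `16` has at
most `1 + 16 + 120 + 560` members. The polynomial `(d / 2 - 1).choose 3` in the distance `d` is odd
at `d = 0` and even at every other distance that occurs. -/
theorem card_le_of_hammingDist_even (F : Finset (Fin 16 → Bool))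
    (hF : ∀ x ∈ F, ∀ y ∈ F, Even (hammingDist x y) ∧ hammingDist x y < 16 ∧
      hammingDist x y ≠ 8) : F.card ≤ 697 := by
  let p : ℕ → ℤ := fun d => ((d - 2) * (d - 4) * (d - 6)) / 48
  -- Coefficients of `(d - 2)(d - 4)(d - 6) / 48` in the basis `d.choose k`, `k ≤ 3`.
  let c : ℕ → ℚ := ![-1, 33 / 48, -18 / 48, 6 / 48] ∘ Fin.ofNat 4
  let M : Matrix F F ℤ := Matrix.of fun x y => p (hammingDist x.1 y.1)
  have hM2 : M.map (Int.castRingHom (ZMod 2)) = 1 := by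
    ext x y
    obtain ⟨he, hlt, h8⟩ := hF x.1 x.2 y.1 y.2
    simp only [M, Matrix.map_apply, Matrix.of_apply, Matrix.one_apply, Subtype.ext_iff,
      ← hammingDist_eq_zero (x := x.1) (y := y.1)]
    generalize hammingDist x.1 y.1 = d at *
    interval_cases d <;> first | (revert he; decide) | exact absurd rfl h8
  have hMQ : M.map (Int.castRingHom ℚ) = Matrix.of fun x y : F => ∑ k ∈ range (3 + 1),
      c k * ((hammingDist x.1 y.1).choose k : ℚ) := by
    ext x y
    obtain ⟨he, hlt, h8⟩ := hF x.1 x.2 y.1 y.2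
    simp only [M, Matrix.map_apply, Matrix.of_apply]
    generalize hammingDist x.1 y.1 = d at *
    interval_cases d <;> first
      -- The integer division in `p` is exact only for even `d`; odd `d` is excluded by `he`.
      | (exfalso; revert he; decide)
      | (norm_num [p, c, sum_range_succ, Fin.ofNat, Nat.choose])
  have h := rank_hammingDist_polynomial_le F c 3
  rw [← hMQ, rank_eq_card_of_map_zmod_two_eq_one M hM2, Fintype.card_coe] at h
  exact h.trans (by decide)

theorem lemma3 (I : Finset (Fin 16 → Bool))
    (hI : (halfDistGraph 16).IsIndepSet (I : Set (Fin 16 → Bool))) :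
    I.card ≤ 3912 := by
  -- Equal parity makes distances even; a shared coordinate excludes distance 16, where the cubic
  -- takes the odd value 35.
  let f : (Fin 16 → Bool) → ZMod 2 × Bool := fun x => (∑ i, if x i then 1 else 0, x 0)
  have hfib : ∀ t ∈ (univ : Finset (ZMod 2 × Bool)), (I.filter fun x => f x = t).card ≤ 697 := by
    intro t _
    refine card_le_of_hammingDist_even _ fun x hx y hy => ?_
    obtain ⟨hxI, hxt⟩ := mem_filter.1 hx
    obtain ⟨hyI, hyt⟩ := mem_filter.1 hy
    have hxy : f x = f y := hxt.trans hyt.symm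
    have hw := congrArg Prod.fst hxy
    have h0 : x 0 = y 0 := congrArg Prod.snd hxy
    refine ⟨?_, ?_, fun h8 => ?_⟩
    · rw [← ZMod.natCast_eq_zero_iff_even, hammingDist_cast_zmod_two]
      exact (congrArg (· + _) hw).trans (CharTwo.add_self_eq_zero _)
    · refine (card_lt_card (filter_ssubset.2 ⟨(0 : Fin 16), mem_univ _, not_not.2 h0⟩)).trans_eq
        (Fintype.card_fin 16)
    · have hne : x ≠ y := by
        rintro rfl
        simp at h8
      exact hI hxI hyI hne ⟨hne, by rw [h8]⟩
  have h := card_le_mul_card_image_of_maps_to (s := I) (t := univ) (f := f)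
    (fun _ _ => mem_univ _) 697 hfib
  -- Four classes give `4 * 697 = 2788`, well below the stated bound.
  refine h.trans ?_
  simp [ZMod.card]
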